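/- **MLMC for scalar conservation laws.** *Setting.* Let $T>0$, $f\in C^1(\mathbb R;\mathbb R^d)$, and consider the scalar conservation law $u_t+\operatorname{div} f(u)=0$ on $\mathbb R^d\times[0,T]$. For $\Delta x>0$ let $\mathcal S^{\Delta x}:L^\infty(\mathbb R^d)\to L^\infty(\mathbb R^d\times[0,T])$ be the numerical evolution operator of a semi-discrete finite volume scheme on the uniform Cartesian mesh of width $\Delta x$, $$\tfrac{d}{dt}u_i(t)+\sum_{k=1}^d\tfrac1{\Delta x}\big(F^{k}_{i+e_k/2}(t)-F^{k}_{i-e_k/2}(t)\big)=0,\qquad u_i(0)=u_0(x_i),$$ where $x_i$ is the midpoint of cell $i$, $F^k_{i+e_k/2}$ depends only on $u_{i+je_k}$, $-p+1\le j\le p$, and is consistent with $f$: for every compact $K\subset\mathbb R$ there is a constant $C_K$ with $|F^k_{i+e_k/2}-f_k(u_i)|\le C_K\sum_{j=-p+1}^{p}|u_i-u_{i+je_k}|$ whenever these values lie in $K$. Let $(\Omega,\Sigma,P)$ be a probability space, $u_0:\Omega\times\mathbb R^d\to\mathbb R$ a measurable random field with $u_0(\omega,\cdot)$ bounded for each $\omega$,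 and $\sigma_x=\mathrm{Law}(u_0(\cdot,x))$. Let $\Delta x_l=2^{-l}\Delta x_0$, let $u^l=\mathcal S^{\Delta x_l}(u_0)$ (assumed jointly measurable in $(\omega,x,t)$) and $\nu^{\Delta x_l}_{x,t}=\mathrm{Law}(u^l(\cdot,x,t))$. Assume that, for some $s>0$, $C\ge0$ and for $P$-almost every $\omega$, the scheme converges to the exact entropy solution $u(\omega,\cdot)$ with initial data $u_0(\omega,\cdot)$ at rate $s$: $$\|u(\omega,\cdot,t)-u^l(\omega,\cdot,t)\|_{L^1(\mathbb R^d)}\le C\,\Delta x_l^{\,s}\qquad\text{for all } l\ge0 \text{ and a.e. } t\in[0,T].$$ Let $\nu$ be a Young measure from $\mathbb R^d\times[0,T]$ to $\mathbb R$ that is an entropy measure valued solution with initial data $\sigma$, that is, in the sense of distributions, $\langle\nu,\mathrm{id}\rangle_t+\operatorname{div}\langle\nu,f\rangle=0$ with $\nu_{x,0}=\sigma_x$, and $\langle\nu,\eta\rangle_t+\operatorname{div}\langle\nu,q\rangle\le0$ for all entropy pairs ($\eta$ convex, $q'=\eta'f'$); and let $\nu^{\Delta x_l}$ converge narrowly to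 $\nu$ along a subsequence: $\langle\psi,\langle\nu^{\Delta x_l},g\rangle\rangle\to\langle\psi,\langle\nu,g\rangle\rangle$ for all $\psi\in L^1$, $g\in C_b$. Here $\langle\mu_z,g\rangle=\int_{\mathbb R} g\,d\mu_z$ and $\langle\psi,h\rangle=\int_{\mathbb R^d\times[0,T]}\psi(z)h(z)\,dz$. For $L\ge0$ and $M_0,\dots,M_L\ge1$, the MLMC estimator is the random family of signed measures $$\mu^{\mathrm{MLMC}}=\frac1{M_0}\sum_{k=1}^{M_0}\delta_{u^{0}_{k}}+\sum_{l=1}^L\frac1{M_l}\sum_{k=1}^{M_l}\big(\delta_{u^{l,+}_{k}}-\delta_{u^{l-1,-}_{k}}\big),$$ where for each $l$ one draws $M_l$ independent samples $u_0^{k,l}$ of $u_0$, and $u^0_k=\mathcal S^{\Delta x_0}(u_0^{k,0})$, $u^{l,+}_k=\mathcal S^{\Delta x_l}(u_0^{k,l})$, $u^{l-1,-}_k=\mathcal S^{\Delta x_{l-1}}(u_0^{k,l})$. (Samples of different levels may be dependent.) $\|\cdot\|_{L^2}$ denotes the $L^2$ norm over the probability space of the samples, and $\|g\|_{\mathrm{Lip}}$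 the least Lipschitz constant of $g$. *Claim.* There are constants $C_1,C_2>0$, depending only on $T$, $s$ and $C$, such that for all bounded Lipschitz $g:\mathbb R\to\mathbb R$ and all $\psi\in L^1\cap L^\infty(\mathbb R^d\times[0,T])$ the level variances satisfy $$\mathrm{Var}\big(\langle\psi,g(u^l)-g(u^{l-1})\rangle\big)\le C_2^2\,\|\psi\|_{L^\infty}^2\|g\|_{\mathrm{Lip}}^2\,\Delta x_l^{2s}\qquad(l\ge1),$$ and, for all $L$ and $M_0,\dots,M_L$, $$\big\|\langle\psi,\langle\nu-\mu^{\mathrm{MLMC}},g\rangle\rangle\big\|_{L^2}\le\big|\langle\psi,\langle\nu-\nu^{\Delta x_L},g\rangle\rangle\big|+C_1\frac{\sqrt{\mathrm{Var}(\langle\psi,g(u^0)\rangle)}}{M_0^{1/2}}+C_2\sum_{l=1}^L\frac{\|\psi\|_{L^\infty}\|g\|_{\mathrm{Lip}}\Delta x_l^{s}}{M_l^{1/2}}.$$ -/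

import Mathlib

open MeasureTheory ProbabilityTheory Filter Topology Set
open scoped ENNReal NNReal BoundedContinuousFunction ZeroAtInfty

noncomputable section

namespace MLMC

/-! ### Space-time domain and test functions -/

/-- Physical space `ℝ^d`. -/
abbrev Space (d : ℕ) := EuclideanSpace ℝ (Fin d)

/-- Lebesgue measure on the time interval `[0,T]`. -/
instance timeMeasureSpace (T : ℝ) : MeasureSpace (Set.Icc (0 : ℝ) T) := Measure.Subtype.measureSpace

instance isFiniteMeasure_time (T : ℝ) : IsFiniteMeasure (volume : Measure (Set.Icc (0 : ℝ) T)) where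
  measure_univ_lt_top := by
    rw [Measure.Subtype.volume_univ measurableSet_Icc.nullMeasurableSet, Real.volume_Icc]
    exact ENNReal.ofReal_lt_top

/-- The space-time domain `ℝ^d × [0,T]`, with Lebesgue measure. -/
abbrev SpaceTime (d : ℕ) (T : ℝ) := Space d × Set.Icc (0 : ℝ) T

/-- The point `(x,t)` of `ℝ^d × [0,T]`, seen in `ℝ^d × ℝ`. -/
def SpaceTime.toProd {d : ℕ} {T : ℝ} (z : SpaceTime d T) : Space d × ℝ := (z.1, (z.2 : ℝ))

/-- The time derivative of a test function. -/
def timeDeriv {d : ℕ} (φ : Space d × ℝ → ℝ) (p : Space d × ℝ) : ℝ :=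
  fderiv ℝ φ p (0, 1)

/-- `∇_x φ(p) · v`, for a vector `v` of `ℝ^d`. -/
def gradDot {d : ℕ} (φ : Space d × ℝ → ℝ) (p : Space d × ℝ) (v : Space d) : ℝ :=
  fderiv ℝ φ p (v, 0)

/-- Test functions in `C_c^1(ℝ^d × [0,T))` (extended to negative times); they need not vanish at
time `0`. -/
structure IsTestFunction {d : ℕ} (T : ℝ) (φ : Space d × ℝ → ℝ) : Prop where
  contDiff : ContDiff ℝ 1 φ
  compact : HasCompactSupport φ
  support : tsupport φ ⊆ {p | p.2 < T}

/-- Nonnegative test functions in `C_c^1(ℝ^d × (0,T))`. -/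
structure IsInteriorTestFunction {d : ℕ} (T : ℝ) (φ : Space d × ℝ → ℝ) : Prop where
  contDiff : ContDiff ℝ 1 φ
  compact : HasCompactSupport φ
  support : tsupport φ ⊆ {p | 0 < p.2 ∧ p.2 < T}
  nonneg : ∀ p, 0 ≤ φ p

/-! ### The scalar conservation law `u_t + div f(u) = 0` -/

/-- `(η, q)` is an entropy pair for the flux `f`: `η` is convex (and `C^1`), and `q' = η' f'`. -/
structure IsEntropyPair {d : ℕ} (f : ℝ → Space d) (η : ℝ → ℝ) (q : ℝ → Space d) : Prop where
  convex : ConvexOn ℝ Set.univ η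
  contDiff : ContDiff ℝ 1 η
  compatible : ∀ v, HasDerivAt q (deriv η v • deriv f v) v

/-- `u ∈ L^∞(ℝ^d × [0,T])` is a weak solution with initial data `u₀`. -/
structure IsWeakSolution {d : ℕ} (f : ℝ → Space d) (T : ℝ) (u₀ : Space d → ℝ)
    (u : SpaceTime d T → ℝ) : Prop where
  memLp : MemLp u ∞ volume
  weak : ∀ φ : Space d × ℝ → ℝ, IsTestFunction T φ →
    (∫ z : SpaceTime d T, (u z * timeDeriv φ z.toProd + gradDot φ z.toProd (f (u z))))
      + ∫ x : Space d, u₀ x * φ (x, 0) = 0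

/-- Entropy solutions: weak solutions with `η(u)_t + div q(u) ≤ 0` for every entropy pair. -/
structure IsEntropySolution {d : ℕ} (f : ℝ → Space d) (T : ℝ) (u₀ : Space d → ℝ)
    (u : SpaceTime d T → ℝ) : Prop extends IsWeakSolution f T u₀ u where
  entropy : ∀ (η : ℝ → ℝ) (q : ℝ → Space d), IsEntropyPair f η q →
    ∀ φ : Space d × ℝ → ℝ, IsInteriorTestFunction T φ →
      0 ≤ ∫ z : SpaceTime d T,
        (η (u z) * timeDeriv φ z.toProd + gradDot φ z.toProd (q (u z)))

/-! ### Young measures -/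

/-- A Young measure from `X` to `ℝ`: a weakly measurable family of probability measures. -/
structure YoungMeasure (X : Type*) [MeasureSpace X] where
  toFun : X → ProbabilityMeasure ℝ
  aemeasurable' : ∀ g : C₀(ℝ, ℝ), AEMeasurable (fun x => ∫ ξ, g ξ ∂(toFun x : Measure ℝ)) volume

/-- The probability measure `ν_x`. -/
def YoungMeasure.at {X : Type*} [MeasureSpace X] (ν : YoungMeasure X) (x : X) : Measure ℝ :=
  (ν.toFun x : Measure ℝ)

instance YoungMeasure.isProbabilityMeasure_at {X : Type*} [MeasureSpace X] (ν : YoungMeasure X)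
    (x : X) : IsProbabilityMeasure (ν.at x) :=
  inferInstanceAs (IsProbabilityMeasure (ν.toFun x : Measure ℝ))

/-- `ν`, regarded as a family of signed measures. -/
def YoungMeasure.signed {X : Type*} [MeasureSpace X] (ν : YoungMeasure X) (x : X) :
    SignedMeasure ℝ :=
  (ν.at x).toSignedMeasure

/-- The law of a random field `u : Ω × X → ℝ`: the Young measure `ν_x = Law(u(·, x))`. -/
def YoungMeasure.law {X Ω : Type*} [MeasureSpace X] [MeasurableSpace Ω] (P : Measure Ω)
    [IsProbabilityMeasure P] (u : Ω → X → ℝ) (hu : Measurable (Function.uncurry u)) :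
    YoungMeasure X where
  toFun x := ⟨P.map (fun ω => u ω x),
    Measure.isProbabilityMeasure_map (hu.comp measurable_prodMk_right).aemeasurable⟩
  aemeasurable' g := by
    have h : ∀ x, ∫ ξ, g ξ ∂(P.map (fun ω => u ω x)) = ∫ ω, g (u ω x) ∂P := fun x =>
      integral_map (hu.comp measurable_prodMk_right).aemeasurable
        g.continuous.aestronglyMeasurable
    have hm : StronglyMeasurable (fun p : X × Ω => g (u p.2 p.1)) :=
      (g.continuous.measurable.comp (hu.comp measurable_swap)).stronglyMeasurable
    simp only [ProbabilityMeasure.coe_mk, h]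
    exact hm.integral_prod_right'.measurable.aemeasurable

/-- The pairing `⟨ψ, ⟨μ, g⟩⟩ = ∫ ψ(x) ⟨μ_x, g⟩ dx` for a family `μ` of signed measures. -/
def pairing {X : Type*} [MeasureSpace X] (ψ : X → ℝ) (μ : X → SignedMeasure ℝ) (g : ℝ → ℝ) : ℝ :=
  ∫ x, ψ x * ∫ᵛ ξ, g ξ ∂<•(μ x)

/-- Narrow convergence of Young measures. -/
def NarrowTendsto {X : Type*} [MeasureSpace X] (ν : ℕ → YoungMeasure X) (ν' : YoungMeasure X) :
    Prop :=
  ∀ (ψ : X → ℝ) (g : ℝ →ᵇ ℝ), MemLp ψ 1 volume →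
    Tendsto (fun n => pairing ψ (ν n).signed g) atTop (𝓝 (pairing ψ ν'.signed g))

/-! ### Entropy measure valued solutions -/

/-- `⟨ν, h⟩` is a well defined locally integrable function (in absolute value); this is automatic
for bounded continuous `h`, or if the `ν_x` live on a common compact set and `h` is continuous. -/
structure HasMoment {X E : Type*} [MeasureSpace X] [TopologicalSpace X] [NormedAddCommGroup E]
    (ν : YoungMeasure X) (h : ℝ → E) : Prop where
  integrable : ∀ᵐ x : X, Integrable h (ν.at x)
  locallyIntegrable : LocallyIntegrable (fun x : X => ∫ ξ, ‖h ξ‖ ∂(ν.at x)) volume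

/-- `ν` is a measure valued solution with initial data `σ`:
`⟨ν, id⟩_t + div ⟨ν, f⟩ = 0` and `ν_{x,0} = σ_x` in the sense of distributions. -/
structure IsMVS {d : ℕ} (f : ℝ → Space d) (T : ℝ) (σ : YoungMeasure (Space d))
    (ν : YoungMeasure (SpaceTime d T)) : Prop where
  moment_id : HasMoment ν (fun ξ : ℝ => ξ)
  moment_flux : HasMoment ν f
  moment_initial : HasMoment σ (fun ξ : ℝ => ξ)
  weak : ∀ φ : Space d × ℝ → ℝ, IsTestFunction T φ →
    (∫ z : SpaceTime d T, (timeDeriv φ z.toProd * (∫ ξ, ξ ∂(ν.at z))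
        + gradDot φ z.toProd (∫ ξ, f ξ ∂(ν.at z))))
      + ∫ x : Space d, φ (x, 0) * ∫ ξ, ξ ∂(σ.at x) = 0

/-- `ν` is an entropy measure valued solution: a measure valued solution with
`⟨ν, η⟩_t + div ⟨ν, q⟩ ≤ 0` for all entropy pairs (for which these pairings are defined). -/
structure IsEMVS {d : ℕ} (f : ℝ → Space d) (T : ℝ) (σ : YoungMeasure (Space d))
    (ν : YoungMeasure (SpaceTime d T)) : Prop extends IsMVS f T σ ν where
  entropy : ∀ (η : ℝ → ℝ) (q : ℝ → Space d), IsEntropyPair f η q →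
    HasMoment ν η → HasMoment ν q →
    ∀ φ : Space d × ℝ → ℝ, IsInteriorTestFunction T φ →
      0 ≤ ∫ z : SpaceTime d T, (timeDeriv φ z.toProd * (∫ ξ, η ξ ∂(ν.at z))
        + gradDot φ z.toProd (∫ ξ, q ξ ∂(ν.at z)))

/-! ### The semi-discrete finite volume scheme -/

/-- A finite volume scheme for `u_t + div f(u) = 0` on uniform Cartesian meshes: a mesh origin,
and for every mesh width `Δx` and direction `k` a numerical flux function. The argument
`v : ℤ → ℝ` of `flux Δx k` lists the values along direction `k`, relative to the cell to the left
of the interface: the flux through the interface between the cells `i` and `i + e_k` is the flux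
function at `v j = u_{i + j e_k}`. -/
structure FVScheme (d : ℕ) (f : ℝ → Space d) where
  origin : Space d
  /-- half width of the stencil -/
  p : ℕ
  one_le_p : 1 ≤ p
  flux : ℝ → Fin d → (ℤ → ℝ) → ℝ
  /-- finite stencil: the flux depends on `u_{i + j e_k}` for `j = -p+1, …, p` only -/
  stencil : ∀ Δx k (v w : ℤ → ℝ), (∀ j ∈ Finset.Icc (1 - (p : ℤ)) p, v j = w j) →
    flux Δx k v = flux Δx k w
  /-- consistency with `f`, in its locally Lipschitz form -/
  consistent : ∀ Δx, 0 < Δx → ∀ K : Set ℝ, IsCompact K → ∃ C > 0, ∀ k (v : ℤ → ℝ),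
    (∀ j ∈ Finset.Icc (1 - (p : ℤ)) p, v j ∈ K) →
      |flux Δx k v - f (v 0) k| ≤ C * ∑ j ∈ Finset.Icc (1 - (p : ℤ)) p, |v 0 - v j|

namespace FVScheme

variable {d : ℕ} {f : ℝ → Space d}

/-- The index of the cell that contains `x`; the cell `i` is
`∏_k [a_k + i_k Δx, a_k + (i_k + 1) Δx)`, where `a` is the origin of the mesh. -/
def cellIndex (A : FVScheme d f) (Δx : ℝ) (x : Space d) : Fin d → ℤ :=
  fun k => ⌊(x k - A.origin k) / Δx⌋

/-- The midpoint of the cell `i`. -/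
def midpoint (A : FVScheme d f) (Δx : ℝ) (i : Fin d → ℤ) : Space d :=
  WithLp.toLp 2 fun k => A.origin k + ((i k : ℝ) + 1 / 2) * Δx

/-- The numerical flux through the interface between the cells `i` and `i + e_k`, for the cell
values `U`. -/
def interfaceFlux (A : FVScheme d f) (Δx : ℝ) (U : (Fin d → ℤ) → ℝ) (k : Fin d)
    (i : Fin d → ℤ) : ℝ :=
  A.flux Δx k fun j => U (i + Pi.single k j)

/-- The cell values `U i t` solve the semi-discrete scheme on `[0,T]` with initial data `v`. -/
structure IsSolution (A : FVScheme d f) (T Δx : ℝ) (v : Space d → ℝ)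
    (U : (Fin d → ℤ) → ℝ → ℝ) : Prop where
  init : ∀ i, U i 0 = v (A.midpoint Δx i)
  ode : ∀ i, ∀ t ∈ Set.Icc (0 : ℝ) T, HasDerivWithinAt (U i)
    (-∑ k, 1 / Δx * (A.interfaceFlux Δx (fun i' => U i' t) k i
      - A.interfaceFlux Δx (fun i' => U i' t) k (i - Pi.single k 1))) (Set.Icc 0 T) t

/-- `S Δx : L^∞(ℝ^d) → L^∞(ℝ^d × [0,T])` is the numerical evolution operator of the scheme: it maps
bounded initial data to the bounded function which on each cell takes the value given by the
semi-discrete scheme. (The initial data are sampled in midpoints, so bounded functions are used, and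
not equivalence classes.) -/
def IsEvolutionOperator (A : FVScheme d f) (T : ℝ)
    (S : ℝ → (Space d → ℝ) → SpaceTime d T → ℝ) : Prop :=
  ∀ Δx, 0 < Δx → ∀ v : Space d → ℝ, Measurable v → (∃ B, ∀ x, |v x| ≤ B) →
    (∃ B, ∀ z, |S Δx v z| ≤ B) ∧
    ∃ U : (Fin d → ℤ) → ℝ → ℝ, A.IsSolution T Δx v U ∧
      ∀ z : SpaceTime d T, S Δx v z = U (A.cellIndex Δx z.1) z.2

end FVScheme

/-! ### The multilevel Monte-Carlo algorithm -/

/-- The mesh widths `Δx_l = 2^{-l} Δx_0`. -/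
def meshWidth (Δx₀ : ℝ) (l : ℕ) : ℝ := Δx₀ / 2 ^ l

/-- The random field `u^l = S^{Δx_l}(u_0)`. -/
def level {d : ℕ} {T : ℝ} {Ω : Type*} (S : ℝ → (Space d → ℝ) → SpaceTime d T → ℝ) (Δx₀ : ℝ)
    (u₀ : Ω → Space d → ℝ) (l : ℕ) (ω : Ω) (z : SpaceTime d T) : ℝ :=
  S (meshWidth Δx₀ l) (u₀ ω) z

/-- The samples of the algorithm. On the sample space `(Ω', P')`, and for every level `l ≤ L`, there
are `M l` independent draws `X l k` from the probability space `(Ω, P)`; the `k`-th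
sample of the initial data at level `l` is `u₀ (X l k)`. Different levels may be dependent. -/
structure IsSampling {Ω Ω' : Type*} [MeasurableSpace Ω] [MeasurableSpace Ω'] (P : Measure Ω)
    (P' : Measure Ω') (L : ℕ) (M : ℕ → ℕ) (X : (l : ℕ) → Fin (M l) → Ω' → Ω) : Prop where
  law : ∀ l ≤ L, ∀ k, MeasurePreserving (X l k) P' P
  indep : ∀ l ≤ L, iIndepFun (X l) P'

/-- The Dirac measure, as a signed measure. -/
def diracSigned (a : ℝ) : SignedMeasure ℝ := (Measure.dirac a).toSignedMeasure

/-- The multilevel Monte-Carlo estimator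
`1/M_0 ∑_k δ_{u^0_k} + ∑_{l=1}^L 1/M_l ∑_k (δ_{u^{l,+}_k} - δ_{u^{l-1,-}_k})`
at the space-time point `z`, for the outcome `ω'` of the sampling. -/
def estimator {d : ℕ} {T : ℝ} {Ω Ω' : Type*} (S : ℝ → (Space d → ℝ) → SpaceTime d T → ℝ) (Δx₀ : ℝ)
    (u₀ : Ω → Space d → ℝ) (L : ℕ) (M : ℕ → ℕ) (X : (l : ℕ) → Fin (M l) → Ω' → Ω)
    (ω' : Ω') (z : SpaceTime d T) : SignedMeasure ℝ :=
  (1 / (M 0 : ℝ)) • ∑ k, diracSigned (level S Δx₀ u₀ 0 (X 0 k ω') z)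
    + ∑ l ∈ Finset.Icc 1 L, (1 / (M l : ℝ)) • ∑ k,
        (diracSigned (level S Δx₀ u₀ l (X l k ω') z)
          - diracSigned (level S Δx₀ u₀ (l - 1) (X l k ω') z))

/-- The Lipschitz seminorm of `g`, i.e. its least Lipschitz constant. -/
def lipSeminorm (g : ℝ → ℝ) : ℝ := ((sInf {K : ℝ≥0 | LipschitzWith K g} : ℝ≥0) : ℝ)

/-- The essential supremum norm of `ψ`. -/
def supNorm {X : Type*} [MeasureSpace X] (ψ : X → ℝ) : ℝ := (eLpNorm ψ ∞ volume).toReal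

/-- For almost every sample, the scheme with mesh widths `Δx_l` converges to the exact solution `u`
with rate `s` and constant `C`: `‖u(·,t) - S^{Δx_l}(u_0)(·,t)‖_{L^1} ≤ C Δx_l^s`. -/
def ConvergesAtRate {d : ℕ} {T : ℝ} {Ω : Type*} [MeasurableSpace Ω] (P : Measure Ω)
    (S : ℝ → (Space d → ℝ) → SpaceTime d T → ℝ) (Δx₀ : ℝ) (u₀ : Ω → Space d → ℝ)
    (u : Ω → SpaceTime d T → ℝ) (C s : ℝ) : Prop :=
  ∀ l : ℕ, ∀ᵐ ω ∂P, ∀ᵐ t : Set.Icc (0 : ℝ) T,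
    eLpNorm (fun x : Space d => u ω (x, t) - level S Δx₀ u₀ l ω (x, t)) 1 volume
      ≤ ENNReal.ofReal (C * meshWidth Δx₀ l ^ s)

end MLMC

end

universe u v

/-!
The estimate is a bias-variance decomposition. Write `Y_l(ω) = ⟨ψ, g(u^l(ω))⟩` (`observable`). By
Fubini's theorem, `⟨ψ, ⟨ν^{Δx_L}, g⟩⟩ = 𝔼 Y_L`, and this telescopes into
`𝔼 Y_0 + ∑_{l=1}^L 𝔼 (Y_l - Y_{l-1})`. Hence the error of the multilevel estimator is the sum of
the deterministic bias `⟨ψ, ⟨ν - ν^{Δx_L}, g⟩⟩`, the Monte Carlo error for `Y_0` and those for the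
differences `Y_l - Y_{l-1}` (`pairing_sub_law`, `pairing_sub_estimator`). Minkowski's inequality
separates the summands, so that different levels may be dependent, and within a level independence
gives the root mean square error `√(Var / M_l)` (`eLpNorm_integral_sub_mean`).

The variances between the levels decay because both `u^l` and `u^{l-1}` are `L¹`-close to the exact
solution: `‖u^l - u^{l-1}‖_{L¹} ≤ C (1 + 2^s) Δx_l^s` at almost every time, so that `Y_l - Y_{l-1}`
is almost surely bounded by `T C (1 + 2^s) ‖ψ‖_∞ ‖g‖_Lip Δx_l^s`
(`ConvergesAtRate.variance_level_sub_le`). This gives `C₁ = 1` and `C₂ = T C (1 + 2^s) + 1`.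

The remaining work is measurability: `⟨ν, g⟩` is measurable for bounded continuous `g`, although
Young measures are only tested against `C₀` (`YoungMeasure.aemeasurable_integral_bcf`), and the
pairing with signed measures is additive since `g` is integrable for all measures involved.
-/

noncomputable section

namespace MLMC

/-! ### Young measures and signed measures paired with bounded continuous functions -/

/-- The defining measurability of a Young measure against `C₀` passes to bounded continuous `g`,
by truncating `g` with cutoff functions and dominated convergence. -/
theorem YoungMeasure.aemeasurable_integral_bcf {X : Type*} [MeasureSpace X] (ν : YoungMeasure X)
    (g : ℝ →ᵇ ℝ) : AEMeasurable (fun x => ∫ ξ, g ξ ∂(ν.at x)) volume := by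
  let χ : ℕ → ℝ → ℝ := fun n ξ => max 0 (min 1 (n + 1 - |ξ|))
  have hχc : ∀ n, Continuous (χ n) := fun n => by fun_prop
  have hχ0 : ∀ n ξ, 0 ≤ χ n ξ := fun n ξ => le_max_left _ _
  have hχ1 : ∀ n ξ, χ n ξ ≤ 1 := fun n ξ => max_le zero_le_one (min_le_left _ _)
  let G : ℕ → C₀(ℝ, ℝ) := fun n =>
    { toFun := fun ξ => g ξ * χ n ξ
      continuous_toFun := g.continuous.mul (hχc n)
      zero_at_infty' := by
        refine tendsto_const_nhds.congr' ?_
        filter_upwards [(tendsto_norm_cocompact_atTop (E := ℝ)).eventually_ge_atTop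
          ((n : ℝ) + 1)] with ξ hξ
        rw [Real.norm_eq_abs] at hξ
        have : χ n ξ = 0 := max_eq_left ((min_le_right _ _).trans (by linarith))
        simp [this] }
  refine aemeasurable_of_tendsto_metrizable_ae atTop (fun n => ν.aemeasurable' (G n))
    (ae_of_all _ fun x => ?_)
  refine tendsto_integral_of_dominated_convergence (fun _ => ‖g‖)
    (fun n => (G n).continuous.aestronglyMeasurable)
    (integrable_const (μ := (ν.at x)) _) (fun n => ae_of_all _ fun ξ => ?_)
    (ae_of_all _ fun ξ => ?_)
  · change ‖g ξ * χ n ξ‖ ≤ ‖g‖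
    rw [norm_mul, Real.norm_of_nonneg (hχ0 n ξ)]
    exact (mul_le_of_le_one_right (norm_nonneg _) (hχ1 n ξ)).trans (g.norm_coe_le_norm ξ)
  · refine tendsto_const_nhds.congr' ?_
    obtain ⟨N, hN⟩ := exists_nat_ge |ξ|
    filter_upwards [eventually_ge_atTop N] with n hn
    have hn' : (N : ℝ) ≤ n := by exact_mod_cast hn
    have : χ n ξ = 1 := by
      change max 0 (min 1 ((n : ℝ) + 1 - |ξ|)) = 1
      rw [min_eq_left (by linarith), max_eq_right zero_le_one]
    change g ξ = g ξ * χ n ξ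
    rw [this, mul_one]

theorem integrable_toSignedMeasure (μ : Measure ℝ) [IsFiniteMeasure μ] (g : ℝ →ᵇ ℝ) :
    μ.toSignedMeasure.Integrable g := by
  rw [VectorMeasure.Integrable, Measure.variation_toSignedMeasure]
  exact g.integrable μ

theorem integrable_diracSigned (a : ℝ) (g : ℝ →ᵇ ℝ) : (diracSigned a).Integrable g :=
  integrable_toSignedMeasure _ g

theorem integral_diracSigned (a : ℝ) (g : ℝ →ᵇ ℝ) :
    ∫ᵛ ξ, g ξ ∂<•(diracSigned a) = g a := by
  rw [diracSigned, VectorMeasure.integral_toSignedMeasure, integral_dirac]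

theorem YoungMeasure.integrable_signed {X : Type*} [MeasureSpace X] (ν : YoungMeasure X) (x : X)
    (g : ℝ →ᵇ ℝ) : (ν.signed x).Integrable g :=
  integrable_toSignedMeasure _ g

section Estimator

variable {d : ℕ} {T : ℝ} {Ω Ω' : Type*} (S : ℝ → (Space d → ℝ) → SpaceTime d T → ℝ) (Δx₀ : ℝ)
  (u₀ : Ω → Space d → ℝ) (L : ℕ) (M : ℕ → ℕ) (X : (l : ℕ) → Fin (M l) → Ω' → Ω)

theorem integrable_estimator (ω' : Ω') (z : SpaceTime d T) (g : ℝ →ᵇ ℝ) :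
    (estimator S Δx₀ u₀ L M X ω' z).Integrable g := by
  refine VectorMeasure.Integrable.add_vectorMeasure (VectorMeasure.Integrable.smul_vectorMeasure
      (VectorMeasure.Integrable.finsetSum_vectorMeasure fun k _ => integrable_diracSigned _ g) _)
    (VectorMeasure.Integrable.finsetSum_vectorMeasure fun l _ =>
      VectorMeasure.Integrable.smul_vectorMeasure
        (VectorMeasure.Integrable.finsetSum_vectorMeasure fun k _ =>
          (integrable_diracSigned _ g).sub_vectorMeasure (integrable_diracSigned _ g)) _)

theorem integral_estimator (ω' : Ω') (z : SpaceTime d T) (g : ℝ →ᵇ ℝ) :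
    ∫ᵛ ξ, g ξ ∂<•(estimator S Δx₀ u₀ L M X ω' z)
      = 1 / (M 0 : ℝ) * ∑ k, g (level S Δx₀ u₀ 0 (X 0 k ω') z)
        + ∑ l ∈ Finset.Icc 1 L, 1 / (M l : ℝ) * ∑ k,
            (g (level S Δx₀ u₀ l (X l k ω') z) - g (level S Δx₀ u₀ (l - 1) (X l k ω') z)) := by
  have hsub : ∀ l, ∀ k ∈ Finset.univ, (diracSigned (level S Δx₀ u₀ l (X l k ω') z)
      - diracSigned (level S Δx₀ u₀ (l - 1) (X l k ω') z)).Integrable g := fun l k _ =>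
    (integrable_diracSigned _ g).sub_vectorMeasure (integrable_diracSigned _ g)
  rw [estimator, VectorMeasure.integral_add_vectorMeasure,
    VectorMeasure.integral_smul_vectorMeasure,
    VectorMeasure.integral_finsetSum_vectorMeasure fun k _ => integrable_diracSigned _ g,
    VectorMeasure.integral_finsetSum_vectorMeasure, smul_eq_mul]
  · simp only [integral_diracSigned]
    congr 1
    refine Finset.sum_congr rfl fun l _ => ?_
    rw [VectorMeasure.integral_smul_vectorMeasure,
      VectorMeasure.integral_finsetSum_vectorMeasure (hsub l), smul_eq_mul]
    congr 1
    refine Finset.sum_congr rfl fun k _ => ?_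
    rw [VectorMeasure.integral_sub_vectorMeasure (integrable_diracSigned _ g)
      (integrable_diracSigned _ g), integral_diracSigned, integral_diracSigned]
  · exact fun l _ => VectorMeasure.Integrable.smul_vectorMeasure
      (VectorMeasure.Integrable.finsetSum_vectorMeasure (hsub l)) _
  · exact VectorMeasure.Integrable.smul_vectorMeasure
      (VectorMeasure.Integrable.finsetSum_vectorMeasure fun k _ => integrable_diracSigned _ g) _
  · exact VectorMeasure.Integrable.finsetSum_vectorMeasure fun l _ =>
      VectorMeasure.Integrable.smul_vectorMeasure
        (VectorMeasure.Integrable.finsetSum_vectorMeasure (hsub l)) _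

end Estimator

/-! ### Observables of random fields -/

section Observable

variable {X Ω : Type*} [MeasureSpace X] [MeasurableSpace Ω]

/-- The observable `⟨ψ, g(w)⟩ = ∫ ψ(z) g(w(ω, z)) dz` of a random field `w`, as a function of the
outcome `ω`. -/
def observable (ψ : X → ℝ) (g : ℝ →ᵇ ℝ) (w : Ω → X → ℝ) (ω : Ω) : ℝ :=
  ∫ z, ψ z * g (w ω z)

variable {ψ : X → ℝ} (hψ : Integrable ψ volume) (g : ℝ →ᵇ ℝ) {w w' : Ω → X → ℝ}
  (hw : Measurable (Function.uncurry w)) (hw' : Measurable (Function.uncurry w'))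

include hψ hw in
theorem integrable_mul_comp_field (ω : Ω) : Integrable (fun z => ψ z * g (w ω z)) volume :=
  hψ.mul_bdd (c := ‖g‖)
    (g.continuous.measurable.comp (hw.comp measurable_prodMk_left)).aestronglyMeasurable
    (ae_of_all _ fun _ => g.norm_coe_le_norm _)

include hψ hw hw' in
theorem observable_sub (ω : Ω) :
    observable ψ g w ω - observable ψ g w' ω = ∫ z, ψ z * (g (w ω z) - g (w' ω z)) := by
  rw [observable, observable, ← integral_sub (integrable_mul_comp_field hψ g hw ω)
    (integrable_mul_comp_field hψ g hw' ω)]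
  simp only [mul_sub]

variable [SFinite (volume : Measure X)] (P : Measure Ω) [IsProbabilityMeasure P]

include hψ hw in
theorem integrable_prod_mul_comp_field :
    Integrable (fun p : Ω × X => ψ p.2 * g (w p.1 p.2)) (P.prod volume) :=
  (hψ.comp_snd P).mul_bdd (c := ‖g‖)
    (g.continuous.measurable.comp hw).aestronglyMeasurable
    (ae_of_all _ fun _ => g.norm_coe_le_norm _)

include hψ hw in
theorem memLp_observable : MemLp (observable ψ g w) 2 P := by
  refine MemLp.of_bound
    (integrable_prod_mul_comp_field hψ g hw P).aestronglyMeasurable.integral_prod_right'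
    (∫ z, ‖ψ z‖ * ‖g‖) (ae_of_all _ fun ω => ?_)
  refine norm_integral_le_of_norm_le (hψ.norm.mul_const _) (ae_of_all _ fun z => ?_)
  rw [norm_mul]
  gcongr
  exact g.norm_coe_le_norm _

include hψ hw in
/-- Fubini: averaging the observable pairs `ψ` with the law of the random field. -/
theorem integral_observable :
    ∫ ω, observable ψ g w ω ∂P = ∫ z, ψ z * ∫ ξ, g ξ ∂((YoungMeasure.law P w hw).at z) := by
  simp only [observable]
  rw [integral_integral_swap (integrable_prod_mul_comp_field hψ g hw P)]
  congr 1
  ext z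
  rw [integral_const_mul]
  congr 1
  exact (integral_map (hw.comp measurable_prodMk_right).aemeasurable
    g.continuous.aestronglyMeasurable).symm

omit [SFinite (volume : Measure X)] in
include hψ in
theorem YoungMeasure.integrable_mul_integral (ν : YoungMeasure X) :
    Integrable (fun z => ψ z * ∫ ξ, g ξ ∂(ν.at z)) volume :=
  hψ.mul_bdd (c := ‖g‖) (ν.aemeasurable_integral_bcf g).aestronglyMeasurable
    (ae_of_all _ fun z => by
      simpa using norm_integral_le_of_norm_le_const (μ := ν.at z)
        (ae_of_all _ fun ξ => g.norm_coe_le_norm ξ))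

include hψ in
theorem pairing_sub_law (ν : YoungMeasure X) :
    pairing ψ (fun z => ν.signed z - (YoungMeasure.law P w hw).signed z) g
      = (∫ z, ψ z * ∫ ξ, g ξ ∂(ν.at z)) - ∫ ω, observable ψ g w ω ∂P := by
  rw [integral_observable hψ g hw P, ← integral_sub (ν.integrable_mul_integral hψ g)
    ((YoungMeasure.law P w hw).integrable_mul_integral hψ g), pairing]
  congr 1
  ext z
  rw [VectorMeasure.integral_sub_vectorMeasure (ν.integrable_signed z g)
    ((YoungMeasure.law P w hw).integrable_signed z g), YoungMeasure.signed, YoungMeasure.signed,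
    VectorMeasure.integral_toSignedMeasure, VectorMeasure.integral_toSignedMeasure, mul_sub]

end Observable

theorem pairing_sub_estimator {d : ℕ} {T : ℝ} {Ω Ω' : Type*} [MeasurableSpace Ω]
    (S : ℝ → (Space d → ℝ) → SpaceTime d T → ℝ) (Δx₀ : ℝ) (u₀ : Ω → Space d → ℝ)
    (hmeas : ∀ l, Measurable (Function.uncurry (level S Δx₀ u₀ l))) (L : ℕ) (M : ℕ → ℕ)
    (X : (l : ℕ) → Fin (M l) → Ω' → Ω) {ψ : SpaceTime d T → ℝ} (hψ : Integrable ψ volume)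
    (g : ℝ →ᵇ ℝ) (ν : YoungMeasure (SpaceTime d T)) (ω' : Ω') :
    pairing ψ (fun z => ν.signed z - estimator S Δx₀ u₀ L M X ω' z) g
      = (∫ z, ψ z * ∫ ξ, g ξ ∂(ν.at z))
        - (1 / (M 0 : ℝ) * ∑ k, observable ψ g (level S Δx₀ u₀ 0) (X 0 k ω')
          + ∑ l ∈ Finset.Icc 1 L, 1 / (M l : ℝ) * ∑ k,
              (observable ψ g (level S Δx₀ u₀ l) (X l k ω')
                - observable ψ g (level S Δx₀ u₀ (l - 1)) (X l k ω'))) := by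
  have hi : ∀ l ω, Integrable (fun z => ψ z * g (level S Δx₀ u₀ l ω z)) volume := fun l ω =>
    integrable_mul_comp_field hψ g (hmeas l) ω
  have hd : ∀ l ω, Integrable (fun z => ψ z * g (level S Δx₀ u₀ l ω z)
      - ψ z * g (level S Δx₀ u₀ (l - 1) ω z)) volume := fun l ω => (hi l ω).sub (hi (l - 1) ω)
  have h0 : Integrable (fun z => 1 / (M 0 : ℝ) * ∑ k, ψ z * g (level S Δx₀ u₀ 0 (X 0 k ω') z))
      volume := (integrable_finsetSum _ fun k _ => hi 0 _).const_mul _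
  have h1 : ∀ l ∈ Finset.Icc 1 L, Integrable (fun z => 1 / (M l : ℝ) * ∑ k,
      (ψ z * g (level S Δx₀ u₀ l (X l k ω') z)
        - ψ z * g (level S Δx₀ u₀ (l - 1) (X l k ω') z))) volume := fun l _ =>
    (integrable_finsetSum _ fun k _ => hd l _).const_mul _
  have hrw : ∀ z, ψ z * ∫ᵛ ξ, g ξ ∂<•(ν.signed z - estimator S Δx₀ u₀ L M X ω' z)
      = ψ z * (∫ ξ, g ξ ∂(ν.at z))
        - (1 / (M 0 : ℝ) * ∑ k, ψ z * g (level S Δx₀ u₀ 0 (X 0 k ω') z)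
          + ∑ l ∈ Finset.Icc 1 L, 1 / (M l : ℝ) * ∑ k,
            (ψ z * g (level S Δx₀ u₀ l (X l k ω') z)
              - ψ z * g (level S Δx₀ u₀ (l - 1) (X l k ω') z))) := fun z => by
    rw [VectorMeasure.integral_sub_vectorMeasure (ν.integrable_signed z g)
      (integrable_estimator S Δx₀ u₀ L M X ω' z g), YoungMeasure.signed,
      VectorMeasure.integral_toSignedMeasure, integral_estimator]
    simp only [mul_add, Finset.mul_sum, mul_sub, mul_left_comm (ψ z)]
  rw [pairing, integral_congr_ae (ae_of_all _ hrw), integral_sub (ν.integrable_mul_integral hψ g)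
    (h0.fun_add (integrable_finsetSum _ h1)), integral_add h0 (integrable_finsetSum _ h1),
    integral_finsetSum _ h1, integral_const_mul, integral_finsetSum _ fun k _ => hi 0 _]
  congr 2
  refine Finset.sum_congr rfl fun l _ => ?_
  rw [integral_const_mul, integral_finsetSum _ fun k _ => hd l _]
  congr 1
  refine Finset.sum_congr rfl fun k _ => ?_
  exact integral_sub (hi l _) (hi (l - 1) _)

/-! ### The Monte Carlo error -/

theorem eLpNorm_sub_integral_two {Ω : Type*} [MeasurableSpace Ω] {P : Measure Ω}
    [IsFiniteMeasure P] {Y : Ω → ℝ} (hY : MemLp Y 2 P) :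
    eLpNorm (fun ω => Y ω - ∫ ω, Y ω ∂P) 2 P = ENNReal.ofReal √(variance Y P) := by
  rw [eLpNorm_eq_lintegral_rpow_enorm_toReal two_ne_zero ENNReal.ofNat_ne_top]
  simp only [ENNReal.toReal_ofNat, ENNReal.rpow_ofNat]
  rw [Real.sqrt_eq_rpow, ← ENNReal.ofReal_rpow_of_nonneg (variance_nonneg _ _) (by norm_num),
    ofReal_variance hY, evariance]

/-- The root mean square error of the empirical mean of `m` independent samples. -/
theorem eLpNorm_integral_sub_mean {Ω Ω' : Type*} [MeasurableSpace Ω] [MeasurableSpace Ω']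
    {P : Measure Ω} [IsProbabilityMeasure P] {P' : Measure Ω'} [IsProbabilityMeasure P']
    {m : ℕ} (hm : 1 ≤ m) {X : Fin m → Ω' → Ω} (hX : ∀ k, MeasurePreserving (X k) P' P)
    (hind : iIndepFun X P') {Y : Ω → ℝ} (hY : MemLp Y 2 P) :
    eLpNorm (fun ω' => (∫ ω, Y ω ∂P) - 1 / (m : ℝ) * ∑ k, Y (X k ω')) 2 P'
      = ENNReal.ofReal (√(variance Y P) / √m) := by
  have hm0 : (m : ℝ) ≠ 0 := by positivity
  have hmem : ∀ k, MemLp (fun ω' => Y (X k ω')) 2 P' := fun k =>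
    hY.comp_measurePreserving (hX k)
  have hpair : iIndepFun (fun k ω' => Y (X k ω')) P' :=
    hind.comp₀ (fun _ => Y) (fun k => (hX k).aemeasurable)
      (fun k => by rw [(hX k).map_eq]; exact hY.aestronglyMeasurable.aemeasurable)
  have hmean : ∀ k, ∫ ω', Y (X k ω') ∂P' = ∫ ω, Y ω ∂P := fun k => by
    rw [← (hX k).map_eq, integral_map (hX k).aemeasurable
      (by rw [(hX k).map_eq]; exact hY.aestronglyMeasurable)]
  have hsum : MemLp (fun ω' => 1 / (m : ℝ) * ∑ k, Y (X k ω')) 2 P' :=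
    (memLp_finsetSum _ fun k _ => hmem k).const_mul _
  have hEsum : ∫ ω', 1 / (m : ℝ) * ∑ k, Y (X k ω') ∂P' = ∫ ω, Y ω ∂P := by
    rw [integral_const_mul, integral_finsetSum _ fun k _ => (hmem k).integrable one_le_two]
    simp only [hmean, Finset.sum_const, Finset.card_univ, Fintype.card_fin, nsmul_eq_mul]
    field_simp
  have hvar : variance (fun ω' => 1 / (m : ℝ) * ∑ k, Y (X k ω')) P' = variance Y P / m := by
    have h := IndepFun.variance_sum (s := Finset.univ) (fun k _ => hmem k)
      (fun i _ j _ hij => hpair.indepFun hij)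
    simp only [(hX _).variance_fun_comp hY.aestronglyMeasurable.aemeasurable, Finset.sum_const,
      Finset.card_univ, Fintype.card_fin, nsmul_eq_mul] at h
    rw [variance_const_mul]
    have h' : variance (fun ω' => ∑ k, Y (X k ω')) P' = m * variance Y P := by
      rw [← h]
      congr 1
      ext ω'
      simp
    rw [h']
    field_simp
  rw [← Real.sqrt_div (variance_nonneg _ _), ← hvar, ← eLpNorm_sub_integral_two hsum, hEsum]
  exact eLpNorm_sub_comm (fun _ => ∫ ω, Y ω ∂P) _ 2 P'

/-! ### Level differences under the convergence rate -/

/-- The set of Lipschitz constants is closed, so that the least one is attained. -/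
theorem lipschitzWith_sInf {g : ℝ → ℝ} (hg : ∃ K, LipschitzWith K g) :
    LipschitzWith (sInf {K : ℝ≥0 | LipschitzWith K g}) g := by
  refine IsClosed.csInf_mem (s := {K : ℝ≥0 | LipschitzWith K g}) ?_ hg (OrderBot.bddBelow _)
  have : {K : ℝ≥0 | LipschitzWith K g}
      = ⋂ p : ℝ × ℝ, {K : ℝ≥0 | edist (g p.1) (g p.2) ≤ K * edist p.1 p.2} := by
    ext K
    simp [LipschitzWith]
  rw [this]
  refine isClosed_iInter fun p => isClosed_le continuous_const ?_
  exact ENNReal.continuous_mul_const (edist_ne_top _ _) |>.comp ENNReal.continuous_coe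

theorem enorm_sub_le_lipSeminorm {g : ℝ → ℝ} (hg : ∃ K, LipschitzWith K g) (a b : ℝ) :
    ‖g a - g b‖ₑ ≤ ENNReal.ofReal (lipSeminorm g) * ‖a - b‖ₑ := by
  have := lipschitzWith_sInf hg a b
  rwa [edist_eq_enorm_sub, edist_eq_enorm_sub, ← ENNReal.ofReal_coe_nnreal] at this

theorem lipSeminorm_nonneg (g : ℝ → ℝ) : 0 ≤ lipSeminorm g := NNReal.coe_nonneg _

theorem supNorm_nonneg {X : Type*} [MeasureSpace X] (ψ : X → ℝ) : 0 ≤ supNorm ψ :=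
  ENNReal.toReal_nonneg

theorem enorm_ae_le_supNorm {X : Type*} [MeasureSpace X] {ψ : X → ℝ} (hψ : MemLp ψ ∞ volume) :
    ∀ᵐ z, ‖ψ z‖ₑ ≤ ENNReal.ofReal (supNorm ψ) := by
  rw [supNorm, ENNReal.ofReal_toReal hψ.eLpNorm_ne_top]
  exact ae_le_eLpNormEssSup

theorem meshWidth_pos {Δx₀ : ℝ} (h : 0 < Δx₀) (l : ℕ) : 0 < meshWidth Δx₀ l := by
  rw [meshWidth]; positivity

theorem meshWidth_pred_rpow {Δx₀ s : ℝ} (h : 0 < Δx₀) {l : ℕ} (hl : 1 ≤ l) :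
    meshWidth Δx₀ (l - 1) ^ s = 2 ^ s * meshWidth Δx₀ l ^ s := by
  rw [← Real.mul_rpow two_pos.le (meshWidth_pos h l).le]
  congr 1
  obtain ⟨n, rfl⟩ := Nat.exists_eq_add_of_le' hl
  rw [meshWidth, meshWidth, Nat.add_sub_cancel, pow_succ]
  field_simp

/-- For fields that are `L¹`-bounded by `K` at almost every time, observables are controlled by
`‖ψ‖_∞ ‖g‖_Lip K T`. -/
theorem abs_integral_mul_sub_le {d : ℕ} {T : ℝ} (hT : 0 ≤ T) {ψ v w : SpaceTime d T → ℝ}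
    (hψ : MemLp ψ ∞ volume) {g : ℝ → ℝ} (hg : ∃ K, LipschitzWith K g) (hv : Measurable v)
    (hw : Measurable w) {K : ℝ} (hK : 0 ≤ K)
    (hvw : ∀ᵐ t : Set.Icc (0 : ℝ) T,
      eLpNorm (fun x : Space d => v (x, t) - w (x, t)) 1 volume ≤ ENNReal.ofReal K) :
    |∫ z, ψ z * (g (v z) - g (w z))| ≤ supNorm ψ * lipSeminorm g * (K * T) := by
  have hsp := supNorm_nonneg ψ
  have hlg := lipSeminorm_nonneg g
  have hL1 : ∫⁻ z, ‖v z - w z‖ₑ ≤ ENNReal.ofReal (K * T) := by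
    change ∫⁻ z, ‖v z - w z‖ₑ ∂((volume : Measure (Space d)).prod volume) ≤ _
    rw [lintegral_prod_symm _ (Measurable.enorm (f := fun z => v z - w z)
      (hv.sub hw)).aemeasurable]
    calc ∫⁻ t, ∫⁻ x, ‖v (x, t) - w (x, t)‖ₑ
        ≤ ∫⁻ _ : Set.Icc (0 : ℝ) T, ENNReal.ofReal K := by
          refine lintegral_mono_ae ?_
          filter_upwards [hvw] with t ht
          rwa [eLpNorm_one_eq_lintegral_enorm] at ht
      _ = ENNReal.ofReal (K * T) := by
          rw [lintegral_const, Measure.Subtype.volume_univ measurableSet_Icc.nullMeasurableSet,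
            Real.volume_Icc, sub_zero, ENNReal.ofReal_mul hK]
  have hmain : ‖∫ z, ψ z * (g (v z) - g (w z))‖ₑ
      ≤ ENNReal.ofReal (supNorm ψ * lipSeminorm g * (K * T)) := by
    calc ‖∫ z, ψ z * (g (v z) - g (w z))‖ₑ ≤ ∫⁻ z, ‖ψ z * (g (v z) - g (w z))‖ₑ :=
          enorm_integral_le_lintegral_enorm _
      _ ≤ ∫⁻ z, ENNReal.ofReal (supNorm ψ * lipSeminorm g) * ‖v z - w z‖ₑ := by
          refine lintegral_mono_ae ?_
          filter_upwards [enorm_ae_le_supNorm hψ] with z hz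
          rw [enorm_mul, ENNReal.ofReal_mul hsp, mul_assoc]
          exact mul_le_mul' hz (enorm_sub_le_lipSeminorm hg _ _)
      _ = ENNReal.ofReal (supNorm ψ * lipSeminorm g) * ∫⁻ z, ‖v z - w z‖ₑ :=
          lintegral_const_mul _ (hv.sub hw).enorm
      _ ≤ ENNReal.ofReal (supNorm ψ * lipSeminorm g) * ENNReal.ofReal (K * T) := by gcongr
      _ = _ := (ENNReal.ofReal_mul (by positivity)).symm
  rwa [← ofReal_norm, ENNReal.ofReal_le_ofReal_iff (by positivity)] at hmain

section Rate

variable {d : ℕ} {T s C : ℝ} {f : ℝ → Space d} {Ω : Type*} [MeasurableSpace Ω]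
  {P : Measure Ω} {S : ℝ → (Space d → ℝ) → SpaceTime d T → ℝ} {Δx₀ : ℝ} {u₀ : Ω → Space d → ℝ}
  {u : Ω → SpaceTime d T → ℝ}

/-- The triangle inequality through the exact solution, whose time slices are measurable at almost
every time. -/
theorem ConvergesAtRate.eLpNorm_level_sub_le (hrate : ConvergesAtRate P S Δx₀ u₀ u C s)
    (hC : 0 ≤ C) (hΔ : 0 < Δx₀) (hmeas : ∀ l, Measurable (Function.uncurry (level S Δx₀ u₀ l)))
    (hu : ∀ᵐ ω ∂P, IsEntropySolution f T (u₀ ω) (u ω)) {l : ℕ} (hl : 1 ≤ l) :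
    ∀ᵐ ω ∂P, ∀ᵐ t : Set.Icc (0 : ℝ) T,
      eLpNorm (fun x : Space d => level S Δx₀ u₀ l ω (x, t) - level S Δx₀ u₀ (l - 1) ω (x, t)) 1
        volume ≤ ENNReal.ofReal (C * (1 + 2 ^ s) * meshWidth Δx₀ l ^ s) := by
  filter_upwards [hu, hrate l, hrate (l - 1)] with ω hω h1 h2
  have hslice : ∀ᵐ t : Set.Icc (0 : ℝ) T,
      AEStronglyMeasurable (fun x : Space d => u ω (x, t)) volume :=
    (AEStronglyMeasurable.prod_swap (μ := (volume : Measure (Set.Icc (0 : ℝ) T)))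
      (ν := (volume : Measure (Space d))) hω.memLp.aestronglyMeasurable).prodMk_left
  filter_upwards [hslice, h1, h2] with t ht h1 h2
  have hm : ∀ l, AEStronglyMeasurable (fun x : Space d => level S Δx₀ u₀ l ω (x, t)) volume :=
    fun l => ((hmeas l).comp
      (measurable_prodMk_left.comp measurable_prodMk_right)).aestronglyMeasurable
  rw [meshWidth_pred_rpow hΔ hl] at h2
  have hr : 0 ≤ meshWidth Δx₀ l ^ s := Real.rpow_nonneg (meshWidth_pos hΔ l).le _
  calc _ = eLpNorm ((fun x : Space d => u ω (x, t) - level S Δx₀ u₀ (l - 1) ω (x, t))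
          - fun x : Space d => u ω (x, t) - level S Δx₀ u₀ l ω (x, t)) 1 volume := by
        congr 1
        ext x
        simp only [Pi.sub_apply]
        ring
    _ ≤ _ := eLpNorm_sub_le (ht.sub (hm _)) (ht.sub (hm _)) le_rfl
    _ ≤ ENNReal.ofReal (C * (2 ^ s * meshWidth Δx₀ l ^ s))
          + ENNReal.ofReal (C * meshWidth Δx₀ l ^ s) := add_le_add h2 h1
    _ = _ := by
        rw [← ENNReal.ofReal_add (by positivity) (by positivity)]
        congr 1
        ring

theorem ConvergesAtRate.variance_level_sub_le [IsProbabilityMeasure P]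
    (hrate : ConvergesAtRate P S Δx₀ u₀ u C s) (hT : 0 ≤ T) (hC : 0 ≤ C) (hΔ : 0 < Δx₀)
    (hmeas : ∀ l, Measurable (Function.uncurry (level S Δx₀ u₀ l)))
    (hu : ∀ᵐ ω ∂P, IsEntropySolution f T (u₀ ω) (u ω)) {ψ : SpaceTime d T → ℝ}
    (hψ1 : MemLp ψ 1 volume) (hψ : MemLp ψ ∞ volume) {g : ℝ →ᵇ ℝ} (hg : ∃ K, LipschitzWith K g)
    {l : ℕ} (hl : 1 ≤ l) :
    variance (fun ω => observable ψ g (level S Δx₀ u₀ l) ω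
        - observable ψ g (level S Δx₀ u₀ (l - 1)) ω) P
      ≤ ((T * C * (1 + 2 ^ s)) * (supNorm ψ * lipSeminorm g * meshWidth Δx₀ l ^ s)) ^ 2 := by
  have hψi := memLp_one_iff_integrable.1 hψ1
  have hr : 0 ≤ meshWidth Δx₀ l ^ s := Real.rpow_nonneg (meshWidth_pos hΔ l).le _
  set B := (T * C * (1 + 2 ^ s)) * (supNorm ψ * lipSeminorm g * meshWidth Δx₀ l ^ s) with hB
  have hbound : ∀ᵐ ω ∂P, observable ψ g (level S Δx₀ u₀ l) ω
      - observable ψ g (level S Δx₀ u₀ (l - 1)) ω ∈ Set.Icc (-B) B := by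
    filter_upwards [hrate.eLpNorm_level_sub_le hC hΔ hmeas hu hl] with ω hω
    rw [observable_sub hψi g (hmeas l) (hmeas (l - 1))]
    refine abs_le.1 ((abs_integral_mul_sub_le hT hψ hg ((hmeas l).comp measurable_prodMk_left)
      ((hmeas (l - 1)).comp measurable_prodMk_left) (by positivity) hω).trans_eq ?_)
    rw [hB]
    ring
  refine (variance_le_sq_of_bounded hbound
    ((memLp_observable hψi g (hmeas l) P).sub
      (memLp_observable hψi g (hmeas (l - 1)) P)).aestronglyMeasurable.aemeasurable).trans_eq ?_
  ring

end Rate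

end MLMC

end

/-! ### The multilevel Monte Carlo estimate -/

open MLMC in
theorem corollary3p3 (T s C : ℝ) (hT : 0 < T) (hs : 0 < s) (hC : 0 ≤ C) :
    ∃ C₁ C₂ : ℝ, 0 < C₁ ∧ 0 < C₂ ∧
      ∀ (d : ℕ) (f : ℝ → Space d), ContDiff ℝ 1 f →
      -- the scheme and its evolution operator
      ∀ (A : FVScheme d f) (S : ℝ → (Space d → ℝ) → SpaceTime d T → ℝ),
        A.IsEvolutionOperator T S →
      -- the random initial data, with law `σ`
      ∀ (Ω : Type u) [MeasurableSpace Ω] (P : Measure Ω) [IsProbabilityMeasure P]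
        (σ : YoungMeasure (Space d)) (u₀ : Ω → Space d → ℝ),
        Measurable (Function.uncurry u₀) →
        (∀ ω, ∃ B, ∀ x, |u₀ ω x| ≤ B) →
        (∀ x, σ.at x = P.map (fun ω => u₀ ω x)) →
      -- the scheme converges to the exact solution at the rate `s`
      ∀ (Δx₀ : ℝ) (_ : 0 < Δx₀)
        (hmeas : ∀ l, Measurable (Function.uncurry (level S Δx₀ u₀ l)))
        (u : Ω → SpaceTime d T → ℝ),
        (∀ᵐ ω ∂P, IsEntropySolution f T (u₀ ω) (u ω)) →
        ConvergesAtRate P S Δx₀ u₀ u C s →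
      ∀ (g : ℝ →ᵇ ℝ) (ψ : SpaceTime d T → ℝ), (∃ K, LipschitzWith K g) →
        MemLp ψ 1 volume → MemLp ψ ∞ volume →
      -- decay of the variances between the levels
      (∀ l, 1 ≤ l →
        variance (fun ω => ∫ z, ψ z *
            (g (level S Δx₀ u₀ l ω z) - g (level S Δx₀ u₀ (l - 1) ω z))) P
          ≤ C₂ ^ 2 * supNorm ψ ^ 2 * lipSeminorm g ^ 2 * meshWidth Δx₀ l ^ (2 * s)) ∧
      -- the error of the multilevel Monte-Carlo estimator
      ∀ ν : YoungMeasure (SpaceTime d T), IsEMVS f T σ ν →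
        (∃ n : ℕ → ℕ, StrictMono n ∧
          NarrowTendsto (fun j => YoungMeasure.law P (level S Δx₀ u₀ (n j)) (hmeas (n j))) ν) →
      ∀ (L : ℕ) (M : ℕ → ℕ), (∀ l ≤ L, 1 ≤ M l) →
      ∀ (Ω' : Type v) [MeasurableSpace Ω'] (P' : Measure Ω') [IsProbabilityMeasure P']
        (X : (l : ℕ) → Fin (M l) → Ω' → Ω), IsSampling P P' L M X →
        eLpNorm (fun ω' => pairing ψ
            (fun z => ν.signed z - estimator S Δx₀ u₀ L M X ω' z) g) 2 P'
          ≤ ENNReal.ofReal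
            (|pairing ψ (fun z => ν.signed z
                - (YoungMeasure.law P (level S Δx₀ u₀ L) (hmeas L)).signed z) g|
              + C₁ * (√(variance (fun ω => ∫ z, ψ z * g (level S Δx₀ u₀ 0 ω z)) P)
                  / √(M 0))
              + C₂ * ∑ l ∈ Finset.Icc 1 L,
                  supNorm ψ * lipSeminorm g * meshWidth Δx₀ l ^ s / √(M l)) := by
  have h2s : (0 : ℝ) < 2 ^ s := Real.rpow_pos_of_pos two_pos s
  -- `T C (1 + 2^s)` suffices for the variances; the `1` keeps the constant positive if `C = 0`.
  refine ⟨1, T * C * (1 + 2 ^ s) + 1, one_pos, by positivity, ?_⟩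
  intro d f _ A S _ Ω _ P _ σ u₀ _ _ _ Δx₀ hΔ hmeas u hu hrate g ψ hg hψ1 hψ
  have hψi := memLp_one_iff_integrable.1 hψ1
  set c := T * C * (1 + 2 ^ s) + 1 with hc
  have hc0 : 0 ≤ c := by positivity
  have hsp := supNorm_nonneg ψ
  have hlg := lipSeminorm_nonneg g
  have hr : ∀ l, 0 ≤ meshWidth Δx₀ l ^ s := fun l => Real.rpow_nonneg (meshWidth_pos hΔ l).le _
  let Y : ℕ → Ω → ℝ := fun l => observable ψ g (level S Δx₀ u₀ l)
  have hY : ∀ l, MemLp (Y l) 2 P := fun l => memLp_observable hψi g (hmeas l) P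
  have hD : ∀ l, MemLp (fun ω => Y l ω - Y (l - 1) ω) 2 P := fun l => (hY l).sub (hY (l - 1))
  have hvar : ∀ l, 1 ≤ l → variance (fun ω => Y l ω - Y (l - 1) ω) P
      ≤ (c * (supNorm ψ * lipSeminorm g * meshWidth Δx₀ l ^ s)) ^ 2 := fun l hl => by
    refine (hrate.variance_level_sub_le hT.le hC hΔ hmeas hu hψ1 hψ hg hl).trans ?_
    have := hr l
    gcongr
    rw [hc]
    linarith
  refine ⟨fun l hl => ?_, ?_⟩
  · have h := hvar l hl
    simp only [Y, observable_sub hψi g (hmeas l) (hmeas (l - 1))] at h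
    refine h.trans_eq ?_
    rw [mul_comm 2 s, Real.rpow_mul (meshWidth_pos hΔ l).le, Real.rpow_two]
    ring
  · intro ν _ _ L M hM Ω' _ P' _ X hX
    have hYX : ∀ l ≤ L, ∀ k, MemLp (fun ω' => Y l (X l k ω')) 2 P' := fun l hl k =>
      (hY l).comp_measurePreserving (hX.law l hl k)
    have hDX : ∀ l ≤ L, ∀ k, MemLp (fun ω' => Y l (X l k ω') - Y (l - 1) (X l k ω')) 2 P' :=
      fun l hl k => (hD l).comp_measurePreserving (hX.law l hl k)
    -- the error of the plain Monte Carlo estimator of the level difference, and of level `0`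
    let E : ℕ → Ω' → ℝ := fun l ω' => (∫ ω, (Y l ω - Y (l - 1) ω) ∂P)
      - 1 / (M l : ℝ) * ∑ k, (Y l (X l k ω') - Y (l - 1) (X l k ω'))
    let E₀ : Ω' → ℝ := fun ω' => (∫ ω, Y 0 ω ∂P) - 1 / (M 0 : ℝ) * ∑ k, Y 0 (X 0 k ω')
    have hE₀ : eLpNorm E₀ 2 P' = ENNReal.ofReal (√(variance (Y 0) P) / √(M 0)) :=
      eLpNorm_integral_sub_mean (hM 0 L.zero_le) (hX.law 0 L.zero_le) (hX.indep 0 L.zero_le) (hY 0)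
    have hE : ∀ l ∈ Finset.Icc 1 L, eLpNorm (E l) 2 P' ≤ ENNReal.ofReal
        (c * (supNorm ψ * lipSeminorm g * meshWidth Δx₀ l ^ s / √(M l))) := fun l hl => by
      obtain ⟨h1, hL⟩ := Finset.mem_Icc.1 hl
      refine (eLpNorm_integral_sub_mean (hM l hL) (hX.law l hL) (hX.indep l hL) (hD l)).trans_le ?_
      rw [← mul_div_assoc]
      have := hr l
      gcongr
      exact Real.sqrt_le_iff.2 ⟨by positivity, hvar l h1⟩
    have hE₀m : AEStronglyMeasurable E₀ P' :=
      aestronglyMeasurable_const.sub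
        ((memLp_finsetSum _ fun k _ => hYX 0 L.zero_le k).const_mul _).aestronglyMeasurable
    have hEm : ∀ l ∈ Finset.Icc 1 L, AEStronglyMeasurable (E l) P' := fun l hl =>
      aestronglyMeasurable_const.sub ((memLp_finsetSum _ fun k _ =>
        hDX l (Finset.mem_Icc.1 hl).2 k).const_mul _).aestronglyMeasurable
    -- the expectations of the level differences telescope
    have htel : ∫ ω, Y L ω ∂P
        = (∫ ω, Y 0 ω ∂P) + ∑ l ∈ Finset.Icc 1 L, ∫ ω, (Y l ω - Y (l - 1) ω) ∂P := by
      have hi : ∀ l, Integrable (Y l) P := fun l => (hY l).integrable one_le_two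
      clear hX hM hYX hDX hE₀ hE hE₀m hEm
      induction L with
      | zero => simp
      | succ n ih =>
        rw [Finset.sum_Icc_succ_top (by omega), ← add_assoc, ← ih, Nat.add_sub_cancel,
          integral_sub (hi _) (hi _)]
        ring
    set b := pairing ψ (fun z => ν.signed z
      - (YoungMeasure.law P (level S Δx₀ u₀ L) (hmeas L)).signed z) g with hb
    have hdecomp : (fun ω' => pairing ψ
        (fun z => ν.signed z - estimator S Δx₀ u₀ L M X ω' z) g)
        = (fun _ => b) + E₀ + ∑ l ∈ Finset.Icc 1 L, E l := by
      ext ω'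
      rw [pairing_sub_estimator S Δx₀ u₀ hmeas L M X hψi g ν ω']
      simp only [Pi.add_apply, Finset.sum_apply, E, E₀, Finset.sum_sub_distrib]
      rw [hb, pairing_sub_law hψi g (hmeas L) P ν]
      change _ = _ - (∫ ω, Y L ω ∂P) + _ + _
      rw [htel]
      simp only [Y]
      ring
    have hconst : eLpNorm (fun _ : Ω' => b) 2 P' = ENNReal.ofReal |b| := by
      rw [eLpNorm_const _ two_ne_zero (IsProbabilityMeasure.ne_zero P'), measure_univ,
        ENNReal.one_rpow, mul_one, ← Real.norm_eq_abs, ofReal_norm]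
    have hterm : ∀ l ∈ Finset.Icc 1 L,
        0 ≤ c * (supNorm ψ * lipSeminorm g * meshWidth Δx₀ l ^ s / √(M l)) := fun l _ => by
      have := hr l
      positivity
    rw [hdecomp, one_mul, Finset.mul_sum, ENNReal.ofReal_add (by positivity)
      (Finset.sum_nonneg hterm), ENNReal.ofReal_add (by positivity) (by positivity),
      ENNReal.ofReal_sum_of_nonneg hterm]
    refine (eLpNorm_add_le (aestronglyMeasurable_const.add hE₀m)
      (Finset.aestronglyMeasurable_sum _ hEm) one_le_two).trans ?_
    refine add_le_add ((eLpNorm_add_le aestronglyMeasurable_const hE₀m one_le_two).trans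
      (add_le_add hconst.le hE₀.le)) ?_
    exact (eLpNorm_sum_le hEm one_le_two).trans (Finset.sum_le_sum hE)
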